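/- Let $a,b,q\in\mathbb{C}$ satisfy $|q|<\min\{|b|,1\}$, and suppose that $a^2q^{k+1}\neq b$ for every integer $k\ge 0$ (so that no denominator below vanishes). Write $(x;q)_n=\prod_{k=0}^{n-1}(1-xq^k)$ for integers $n\ge 0$ and $(x;q)_\infty=\prod_{k=0}^{\infty}(1-xq^k)$. Then the series on the left converges absolutely and $$\sum_{r=0}^{\infty}\frac{(1+aq^r)\,(a^2;q)_r\,(b;q)_r\,(-a/b)^r\,q^{r(r+1)/2}}{(a^2q/b;q)_r\,(q;q)_r}=\frac{(-a;q)_\infty\,(a^2q;q^2)_\infty\,(aq/b;q)_\infty}{(a^2q/b;q)_\infty}.$$ -/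

import Mathlib

/-- The finite `q`-shifted factorial `(x; q)_n = (1 - x) (1 - x q) ⋯ (1 - x q ^ (n - 1))`. -/
noncomputable def qPoch (x q : ℂ) (n : ℕ) : ℂ :=
  ∏ k ∈ Finset.range n, (1 - x * q ^ k)

/-- The infinite `q`-shifted factorial `(x; q)_∞ = ∏_{k ≥ 0} (1 - x q ^ k)`, used for `|q| < 1`. -/
noncomputable def qPochInf (x q : ℂ) : ℂ :=
  ∏' k : ℕ, (1 - x * q ^ k)

/-- For `|q| < 1` the product defining `(x; q)_∞` converges, so no default value is involved. -/
theorem qPochInf_hasProd (x q : ℂ) (hq : ‖q‖ < 1) :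
    HasProd (fun k : ℕ => 1 - x * q ^ k) (qPochInf x q) := by
  have h : Multipliable (fun k : ℕ => 1 + -(x * q ^ k)) := by
    apply multipliable_one_add_of_summable
    simp only [norm_neg, norm_mul, norm_pow]
    exact (summable_geometric_of_lt_one (norm_nonneg q) hq).mul_left ‖x‖
  simp only [← sub_eq_add_neg] at h
  exact h.hasProd

/-! Let `S(a)` be the sum of the series. The combination of summands at `a` and `aq` telescopes
(`sum_poisedTerm_sub`) with a remainder tending to zero, so `S(a) = poisedRatio a b q * S(aq)`.
Iterating `N` times produces finite products that converge to the right-hand side, times `S(a q^N)`.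
Dominated convergence gives `S(a q^N) → S(0) = 1`, since only the term `r = 0` survives at `a = 0`.
All estimates rest on `q^(n(n+1)/2)` beating every geometric growth. -/

theorem qPoch_succ (x q : ℂ) (n : ℕ) : qPoch x q (n + 1) = qPoch x q n * (1 - x * q ^ n) :=
  Finset.prod_range_succ _ _

theorem qPoch_zero (x q : ℂ) : qPoch x q 0 = 1 := Finset.prod_range_zero _

theorem qPoch_succ_left (x q : ℂ) (n : ℕ) :
    qPoch x q (n + 1) = (1 - x) * qPoch (x * q) q n := by
  simp only [qPoch, Finset.prod_range_succ']
  rw [mul_comm]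
  congr 1
  · simp
  · exact Finset.prod_congr rfl fun k _ => by ring

theorem qPoch_ne_zero {x q : ℂ} (h : ∀ k : ℕ, x * q ^ k ≠ 1) (n : ℕ) : qPoch x q n ≠ 0 :=
  Finset.prod_ne_zero_iff.2 fun k _ => sub_ne_zero.2 (h k).symm

theorem mul_pow_self_ne_one {q : ℂ} (hq : ‖q‖ < 1) (k : ℕ) : q * q ^ k ≠ 1 := by
  intro h
  have h1 : ‖q ^ (k + 1)‖ = 1 := by rw [pow_succ', h, norm_one]
  rw [norm_pow] at h1
  exact (pow_lt_one₀ (norm_nonneg q) hq k.succ_ne_zero).ne h1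

theorem norm_qPoch_le {x q : ℂ} {B : ℝ} (hq : ‖q‖ ≤ 1) (hx : ‖x‖ ≤ B) (n : ℕ) :
    ‖qPoch x q n‖ ≤ (1 + B) ^ n := by
  rw [qPoch, norm_prod]
  refine (Finset.prod_le_prod (fun _ _ => norm_nonneg _) fun k _ => ?_).trans_eq
    (by rw [Finset.prod_const, Finset.card_range])
  calc ‖1 - x * q ^ k‖ ≤ ‖(1 : ℂ)‖ + ‖x * q ^ k‖ := norm_sub_le _ _
    _ ≤ 1 + B := by
      rw [norm_one, norm_mul, norm_pow]
      gcongr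
      exact (mul_le_of_le_one_right (norm_nonneg x) (pow_le_one₀ (norm_nonneg q) hq)).trans hx

theorem le_norm_qPoch {x q : ℂ} {δ : ℝ} (hδ : 0 ≤ δ) (h : ∀ k : ℕ, δ ≤ ‖1 - x * q ^ k‖) (n : ℕ) :
    δ ^ n ≤ ‖qPoch x q n‖ := by
  rw [qPoch, norm_prod]
  refine (Finset.prod_le_prod (fun _ _ => hδ) fun k _ => h k).trans_eq' ?_
  rw [Finset.prod_const, Finset.card_range]

theorem tendsto_one_sub_mul_pow {q : ℂ} (hq : ‖q‖ < 1) (x : ℂ) :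
    Filter.Tendsto (fun k : ℕ => 1 - x * q ^ k) Filter.atTop (nhds 1) := by
  simpa using ((tendsto_pow_atTop_nhds_zero_of_norm_lt_one hq).const_mul x).const_sub 1

/-- The factors of a nonvanishing product `(x; q)_∞` are bounded away from zero. -/
theorem exists_le_norm_one_sub_mul_pow {x q : ℂ} (hq : ‖q‖ < 1) (h : ∀ k : ℕ, x * q ^ k ≠ 1) :
    ∃ δ : ℝ, 0 < δ ∧ ∀ k : ℕ, δ ≤ ‖1 - x * q ^ k‖ := by
  have h1 : Filter.Tendsto (fun k : ℕ => (‖1 - x * q ^ k‖)⁻¹) Filter.atTop (nhds 1) := by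
    simpa using (tendsto_one_sub_mul_pow hq x).norm.inv₀ (by simp)
  obtain ⟨M, hM⟩ := h1.bddAbove_range
  have hpos : ∀ k : ℕ, 0 < ‖1 - x * q ^ k‖ := fun k =>
    norm_pos_iff.2 (sub_ne_zero.2 (h k).symm)
  have hle : ∀ k : ℕ, (‖1 - x * q ^ k‖)⁻¹ ≤ M := fun k => hM ⟨k, rfl⟩
  have hM0 : 0 < M := (inv_pos.2 (hpos 0)).trans_le (hle 0)
  exact ⟨M⁻¹, inv_pos.2 hM0, fun k => (inv_le_comm₀ (hpos k) hM0).1 (hle k)⟩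

theorem qPochInf_ne_zero {x q : ℂ} (hq : ‖q‖ < 1) (h : ∀ k : ℕ, x * q ^ k ≠ 1) :
    qPochInf x q ≠ 0 := by
  have := tprod_one_add_ne_zero_of_summable (f := fun k : ℕ => -(x * q ^ k))
    (fun k => by rw [← sub_eq_add_neg]; exact sub_ne_zero.2 (h k).symm) (by
      simp only [norm_neg, norm_mul, norm_pow]
      exact (summable_geometric_of_lt_one (norm_nonneg q) hq).mul_left ‖x‖)
  simpa only [← sub_eq_add_neg, qPochInf] using this

theorem tendsto_qPoch {q : ℂ} (hq : ‖q‖ < 1) (x : ℂ) :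
    Filter.Tendsto (qPoch x q) Filter.atTop (nhds (qPochInf x q)) :=
  (qPochInf_hasProd x q hq).tendsto_prod_nat

theorem triangle_succ (n : ℕ) : (n + 1) * (n + 1 + 1) / 2 = n * (n + 1) / 2 + (n + 1) := by
  rw [show (n + 1) * (n + 1 + 1) = n * (n + 1) + (n + 1) * 2 by ring,
    Nat.add_mul_div_right _ _ two_pos]

/-- Consecutive terms have ratio `K ρ^(n+1) → 0`, so `K` may be arbitrarily large and crude
geometric bounds on the shifted factorials suffice. -/
theorem summable_pow_mul_pow_triangle {ρ : ℝ} (h0 : 0 ≤ ρ) (h1 : ρ < 1) (K : ℝ) :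
    Summable fun n : ℕ => K ^ n * ρ ^ (n * (n + 1) / 2) := by
  have h : Filter.Tendsto (fun n : ℕ => |K| * ρ ^ (n + 1)) Filter.atTop (nhds 0) := by
    simpa using ((Filter.tendsto_add_atTop_iff_nat 1).2
      (tendsto_pow_atTop_nhds_zero_of_lt_one h0 h1)).const_mul |K|
  refine summable_of_ratio_norm_eventually_le (r := 1 / 2) (by norm_num) ?_
  filter_upwards [h.eventually_le_const (show (0 : ℝ) < 1 / 2 by norm_num)] with n hn
  rw [triangle_succ, pow_succ, pow_add,
    show K ^ n * K * (ρ ^ (n * (n + 1) / 2) * ρ ^ (n + 1))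
      = K * ρ ^ (n + 1) * (K ^ n * ρ ^ (n * (n + 1) / 2)) by ring, norm_mul]
  refine mul_le_mul_of_nonneg_right ?_ (norm_nonneg _)
  rwa [norm_mul, Real.norm_eq_abs, Real.norm_of_nonneg (pow_nonneg h0 _)]

/-! ### Telescoping between `a` and `aq` -/

/-- The summand of a limiting case of the very-well-poised `₆φ₅` series. -/
noncomputable def poisedTerm (a b q : ℂ) (r : ℕ) : ℂ :=
  (1 + a * q ^ r) * qPoch (a ^ 2) q r * qPoch b q r * (-a / b) ^ r * q ^ (r * (r + 1) / 2) /
    (qPoch (a ^ 2 * q / b) q r * qPoch q q r)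

/-- The ratio of the sums of `poisedTerm` at `a` and at `a * q`. -/
noncomputable def poisedRatio (a b q : ℂ) : ℂ :=
  (1 + a) * (1 - a ^ 2 * q) * (1 - a * q / b) /
    ((1 - a ^ 2 * q / b) * (1 - a ^ 2 * q / b * q))

/-- The telescoped sum of `poisedTerm a b q r - poisedRatio a b q * poisedTerm (a * q) b q r`
over `r ≤ n`. -/
noncomputable def poisedRemainder (a b q : ℂ) (n : ℕ) : ℂ :=
  (1 + a) * qPoch (a ^ 2 * q) q n * qPoch b q (n + 1) * (-a / b) ^ (n + 1) *
      q ^ ((n + 1) * (n + 1 + 1) / 2) * (a ^ 2 * (1 - a * q / b) * q ^ (n + 1) - (1 - a)) /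
    (qPoch (a ^ 2 * q / b) q (n + 2) * qPoch q q n)

/-- The two denominator factors of the ratio complete `(a²q³/b; q)_n` to `(a²q/b; q)_(n+2)`, the
denominator of the remainder. -/
theorem poisedRatio_mul_poisedTerm {a b q : ℂ} (hden : ∀ k : ℕ, a ^ 2 * q / b * q ^ k ≠ 1)
    (n : ℕ) :
    poisedRatio a b q * poisedTerm (a * q) b q n =
      (1 + a) * (1 - a * q / b) * (1 + a * q * q ^ n) * qPoch (a ^ 2 * q) q (n + 1) *
        qPoch b q n * (-a / b) ^ n * q ^ n * q ^ (n * (n + 1) / 2) /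
      (qPoch (a ^ 2 * q / b) q (n + 2) * qPoch q q n) := by
  have h0 : 1 - a ^ 2 * q / b ≠ 0 := sub_ne_zero.2 (by simpa using (hden 0).symm)
  have h1 : 1 - a ^ 2 * q / b * q ≠ 0 := sub_ne_zero.2 (by simpa using (hden 1).symm)
  rw [poisedRatio, poisedTerm, qPoch_succ_left (a ^ 2 * q), qPoch_succ_left (a ^ 2 * q / b),
    qPoch_succ_left (a ^ 2 * q / b * q), show (a * q) ^ 2 = a ^ 2 * q * q by ring,
    show a ^ 2 * q * q * q / b = a ^ 2 * q / b * q * q by ring,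
    show -(a * q) / b = -a / b * q by ring, mul_pow, div_mul_div_comm]
  congr 1 <;> ring

theorem sum_poisedTerm_sub {a b q : ℂ} (hb : b ≠ 0) (hq : ‖q‖ < 1)
    (hden : ∀ k : ℕ, a ^ 2 * q / b * q ^ k ≠ 1) (n : ℕ) :
    ∑ r ∈ Finset.range (n + 1), (poisedTerm a b q r - poisedRatio a b q * poisedTerm (a * q) b q r)
      = poisedRemainder a b q n := by
  simp only [poisedRatio_mul_poisedTerm hden]
  have hd : ∀ k : ℕ, 1 - a * (a * q / b) * q ^ k ≠ 0 := fun k => by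
    rw [show a * (a * q / b) = a ^ 2 * q / b by ring]
    exact sub_ne_zero.2 (hden k).symm
  -- With `s = aq/b` the right side is `aqz - s`. This removes the remaining `b`, so what is left to
  -- check is a rational identity in `a`, `s`, `q`, `z = q^(n+1)`.
  have hs : ∀ z : ℂ, (1 - b * z) * (-a / b) * q = a * q * z - a * q / b := fun z => by
    field_simp
    ring
  have hden' : ∀ n, qPoch (a * (a * q / b)) q n ≠ 0 := fun n => by
    rw [show a * (a * q / b) = a ^ 2 * q / b by ring]
    exact qPoch_ne_zero hden n
  simp only [poisedRemainder, poisedTerm, show a ^ 2 * q / b = a * (a * q / b) by ring]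
  induction n with
  | zero =>
    have h0 := hd 0
    have h1 := hd 1
    have hs1 := hs 1
    simp only [Finset.sum_range_one, qPoch_succ, qPoch_zero, zero_add]
    norm_num at h0 h1 hs1 ⊢
    generalize a * q / b = s at *
    rw [show (1 + a) * (1 - b) * (-a / b) * q = (1 + a) * ((1 - b) * (-a / b) * q) by ring, hs1]
    field_simp
    ring
  | succ n ih =>
    rw [Finset.sum_range_succ, ih]
    have hQ : qPoch q q n ≠ 0 := qPoch_ne_zero (mul_pow_self_ne_one hq) n
    have hQ1 : 1 - q ^ (n + 1) ≠ 0 := by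
      rw [pow_succ']
      exact sub_ne_zero.2 (mul_pow_self_ne_one hq n).symm
    have hD := hden' (n + 1)
    have h1 := hd (n + 1)
    have h2 : 1 - a * (a * q / b) * (q * q ^ (n + 1)) ≠ 0 := by
      rw [← pow_succ']
      exact hd (n + 2)
    have hs1 := hs (q ^ (n + 1))
    rw [qPoch_succ_left (a ^ 2) q n, triangle_succ (n + 1), pow_succ (-a / b) (n + 1),
      qPoch_succ b q (n + 1), qPoch_succ _ q (n + 2), qPoch_succ _ q (n + 1), qPoch_succ q q n,
      qPoch_succ (a ^ 2 * q) q (n + 1), qPoch_succ (a ^ 2 * q) q n, pow_add q _ (n + 1 + 1),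
      show q * q ^ n = q ^ (n + 1) by ring, show a ^ 2 * q * q ^ n = a ^ 2 * q ^ (n + 1) by ring,
      show q ^ (n + 2) = q * q ^ (n + 1) by ring]
    generalize qPoch (a ^ 2 * q) q n = A at *
    generalize qPoch b q (n + 1) = B at *
    generalize qPoch q q n = Q at *
    generalize (-a / b) ^ (n + 1) = E at *
    generalize q ^ ((n + 1) * (n + 1 + 1) / 2) = T at *
    generalize q ^ (n + 1) = z at *
    rw [show ∀ u v : ℂ, (1 + a) * (A * (1 - a ^ 2 * z)) * (B * (1 - b * z)) * (E * (-a / b)) *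
        (T * (q * z)) * u / v =
      (1 + a) * (A * (1 - a ^ 2 * z)) * B * E * T * z * ((1 - b * z) * (-a / b) * q) * u / v by
        intro u v; ring, hs1]
    generalize qPoch (a * (a * q / b)) q (n + 1) = D at *
    generalize a * q / b = s at *
    clear ih hs hs1 hden' hden hd
    have h3 : 1 - a * s * z * q ≠ 0 := by rwa [mul_assoc, mul_comm z q]
    field_simp
    ring

/-! ### Majorants and limits -/

/-- A summand of a `q`-hypergeometric series with quadratic exponent of `q`. -/
noncomputable def qHypTerm (x b c y q : ℂ) (n : ℕ) : ℂ :=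
  qPoch x q n * qPoch b q n * y ^ n * q ^ (n * (n + 1) / 2) / (qPoch c q n * qPoch q q n)

theorem norm_qHypTerm_le {x b c y q : ℂ} {X Y δ ε : ℝ} (hq : ‖q‖ ≤ 1) (hx : ‖x‖ ≤ X)
    (hy : ‖y‖ ≤ Y) (hδ : 0 < δ) (hε : 0 < ε) (hc : ∀ k : ℕ, δ ≤ ‖1 - c * q ^ k‖)
    (hqq : ∀ k : ℕ, ε ≤ ‖1 - q * q ^ k‖) (n : ℕ) :
    ‖qHypTerm x b c y q n‖ ≤
      ((1 + X) * (1 + ‖b‖) * Y / (δ * ε)) ^ n * ‖q‖ ^ (n * (n + 1) / 2) := by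
  have hX : 0 ≤ X := (norm_nonneg x).trans hx
  have hY : 0 ≤ Y := (norm_nonneg y).trans hy
  have h1 := norm_qPoch_le hq hx n
  have h2 := norm_qPoch_le hq (le_refl ‖b‖) n
  have h3 := le_norm_qPoch hδ.le hc n
  have h4 := le_norm_qPoch hε.le hqq n
  rw [qHypTerm, norm_div, norm_mul, norm_mul, norm_mul, norm_mul, norm_pow, norm_pow]
  calc _ ≤ (1 + X) ^ n * (1 + ‖b‖) ^ n * Y ^ n * ‖q‖ ^ (n * (n + 1) / 2) / (δ ^ n * ε ^ n) := by
        gcongr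
    _ = _ := by
        rw [div_pow, mul_pow, mul_pow, mul_pow]
        ring

theorem poisedTerm_eq_mul_qHypTerm (a b q : ℂ) (r : ℕ) :
    poisedTerm a b q r
      = (1 + a * q ^ r) * qHypTerm (a ^ 2) b (a ^ 2 * q / b) (-a / b) q r := by
  rw [poisedTerm, qHypTerm]
  ring

/-- The majorant sees `a` only through `A`, `δ`, `ε`, hence serves all `a q^N` at once in the
dominated convergence. -/
theorem norm_poisedTerm_le {a b q : ℂ} {A δ ε : ℝ} (hq : ‖q‖ ≤ 1) (ha : ‖a‖ ≤ A)
    (hδ : 0 < δ) (hε : 0 < ε) (hc : ∀ k : ℕ, δ ≤ ‖1 - a ^ 2 * q / b * q ^ k‖)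
    (hqq : ∀ k : ℕ, ε ≤ ‖1 - q * q ^ k‖) (r : ℕ) :
    ‖poisedTerm a b q r‖ ≤ (1 + A) *
      (((1 + A ^ 2) * (1 + ‖b‖) * (A / ‖b‖) / (δ * ε)) ^ r * ‖q‖ ^ (r * (r + 1) / 2)) := by
  rw [poisedTerm_eq_mul_qHypTerm, norm_mul]
  have hA : 0 ≤ A := (norm_nonneg a).trans ha
  refine mul_le_mul ?_ (norm_qHypTerm_le hq ?_ ?_ hδ hε hc hqq r) (norm_nonneg _) (by positivity)
  · calc ‖1 + a * q ^ r‖ ≤ ‖(1 : ℂ)‖ + ‖a * q ^ r‖ := norm_add_le _ _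
      _ ≤ 1 + A := by
        rw [norm_one, norm_mul, norm_pow]
        gcongr
        exact (mul_le_of_le_one_right (norm_nonneg a)
          (pow_le_one₀ (norm_nonneg q) hq)).trans ha
  · rw [norm_pow]
    gcongr
  · rw [norm_div, norm_neg]
    gcongr

theorem summable_poisedTerm {a b q : ℂ} (hq : ‖q‖ < 1)
    (hden : ∀ k : ℕ, a ^ 2 * q / b * q ^ k ≠ 1) : Summable (poisedTerm a b q) := by
  obtain ⟨δ, hδ, hc⟩ := exists_le_norm_one_sub_mul_pow hq hden
  obtain ⟨ε, hε, hqq⟩ := exists_le_norm_one_sub_mul_pow hq (mul_pow_self_ne_one hq)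
  exact Summable.of_norm_bounded ((summable_pow_mul_pow_triangle (norm_nonneg q) hq _).mul_left _)
    (norm_poisedTerm_le hq.le le_rfl hδ hε hc hqq)

theorem tendsto_poisedRemainder {a b q : ℂ} (hq : ‖q‖ < 1)
    (hden : ∀ k : ℕ, a ^ 2 * q / b * q ^ k ≠ 1) :
    Filter.Tendsto (poisedRemainder a b q) Filter.atTop (nhds 0) := by
  obtain ⟨δ, hδ, hc⟩ := exists_le_norm_one_sub_mul_pow hq hden
  obtain ⟨ε, hε, hqq⟩ := exists_le_norm_one_sub_mul_pow hq (mul_pow_self_ne_one hq)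
  have h1 : Filter.Tendsto (qHypTerm (a ^ 2 * q) b (a ^ 2 * q / b) (-a / b) q) Filter.atTop
      (nhds 0) :=
    squeeze_zero_norm (norm_qHypTerm_le hq.le le_rfl le_rfl hδ hε hc hqq)
      (summable_pow_mul_pow_triangle (norm_nonneg q) hq _).tendsto_atTop_zero
  have hpow : Filter.Tendsto (fun n : ℕ => q ^ (n + 1)) Filter.atTop (nhds 0) :=
    (Filter.tendsto_add_atTop_iff_nat 1).2 (tendsto_pow_atTop_nhds_zero_of_norm_lt_one hq)
  have hd := tendsto_one_sub_mul_pow hq (a ^ 2 * q / b)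
  -- The cofactor of the `qHypTerm` in the remainder; only its convergence matters.
  have h2 := ((((tendsto_one_sub_mul_pow hq b).mul hpow).mul
    ((hpow.const_mul (a ^ 2 * (1 - a * q / b))).sub_const (1 - a))).div
    (hd.mul ((Filter.tendsto_add_atTop_iff_nat 1).2 hd)) (by simp)).const_mul
      ((1 + a) * (-a / b))
  have h3 := h1.mul h2
  rw [zero_mul] at h3
  refine h3.congr fun n => ?_
  simp only [qHypTerm, poisedRemainder, triangle_succ, qPoch_succ, Pi.div_apply]
  rw [← mul_div_assoc, div_mul_div_comm]
  congr 1 <;> ring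

/-! ### Functional equation and its iteration -/

theorem tsum_poisedTerm_eq_mul {a b q : ℂ} (hb : b ≠ 0) (hq : ‖q‖ < 1)
    (hden : ∀ k : ℕ, a ^ 2 * q / b * q ^ k ≠ 1) :
    ∑' r, poisedTerm a b q r = poisedRatio a b q * ∑' r, poisedTerm (a * q) b q r := by
  have hden' : ∀ k : ℕ, (a * q) ^ 2 * q / b * q ^ k ≠ 1 := fun k => by
    rw [show (a * q) ^ 2 * q / b * q ^ k = a ^ 2 * q / b * q ^ (k + 2) by ring]
    exact hden _
  have h1 := summable_poisedTerm hq hden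
  have h2 := (summable_poisedTerm hq hden').mul_left (poisedRatio a b q)
  have h3 := ((h1.sub h2).hasSum.tendsto_sum_nat.comp (Filter.tendsto_add_atTop_nat 1)).congr
    (sum_poisedTerm_sub hb hq hden)
  have h4 := tendsto_nhds_unique h3 (tendsto_poisedRemainder hq hden)
  rw [h1.tsum_sub h2, tsum_mul_left] at h4
  exact sub_eq_zero.1 h4

/-- Replacing `a` by `aq` multiplies `a²q` and `a²q/b` by `q²`. Hence base `q²` in the numerator,
while the two denominator factors per step fill `2 * N` consecutive places in base `q`. -/
theorem tsum_poisedTerm_eq_qPoch_mul {a b q : ℂ} (hb : b ≠ 0) (hq : ‖q‖ < 1)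
    (hden : ∀ k : ℕ, a ^ 2 * q / b * q ^ k ≠ 1) (N : ℕ) :
    ∑' r, poisedTerm a b q r =
      qPoch (-a) q N * qPoch (a ^ 2 * q) (q ^ 2) N * qPoch (a * q / b) q N /
        qPoch (a ^ 2 * q / b) q (2 * N) * ∑' r, poisedTerm (a * q ^ N) b q r := by
  induction N with
  | zero => simp [qPoch_zero]
  | succ N ih =>
    rw [ih, tsum_poisedTerm_eq_mul (a := a * q ^ N) hb hq, ← mul_assoc, poisedRatio,
      div_mul_div_comm, show 2 * (N + 1) = 2 * N + 1 + 1 by ring]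
    · simp only [qPoch_succ]
      rw [show a * q ^ N * q = a * q ^ (N + 1) by ring]
      congr 2 <;> ring
    · intro k
      rw [show (a * q ^ N) ^ 2 * q / b * q ^ k = a ^ 2 * q / b * q ^ (2 * N + k) by ring]
      exact hden _

theorem tendsto_tsum_poisedTerm {a b q : ℂ} (hq : ‖q‖ < 1)
    (hden : ∀ k : ℕ, a ^ 2 * q / b * q ^ k ≠ 1) :
    Filter.Tendsto (fun N : ℕ => ∑' r, poisedTerm (a * q ^ N) b q r) Filter.atTop (nhds 1) := by
  obtain ⟨δ, hδ, hc⟩ := exists_le_norm_one_sub_mul_pow hq hden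
  obtain ⟨ε, hε, hqq⟩ := exists_le_norm_one_sub_mul_pow hq (mul_pow_self_ne_one hq)
  have h0 : ∑' r, poisedTerm 0 b q r = 1 := by
    rw [tsum_eq_single 0 fun r hr => by simp [poisedTerm, hr]]
    simp [poisedTerm, qPoch_zero]
  have ht : Filter.Tendsto (fun N : ℕ => a * q ^ N) Filter.atTop (nhds 0) := by
    simpa using (tendsto_pow_atTop_nhds_zero_of_norm_lt_one hq).const_mul a
  rw [← h0]
  refine tendsto_tsum_of_dominated_convergence
    ((summable_pow_mul_pow_triangle (norm_nonneg q) hq _).mul_left _) (fun r => ?_)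
    (Filter.Eventually.of_forall fun N => norm_poisedTerm_le hq.le (A := ‖a‖) ?_ hδ hε ?_ hqq)
  · have hcont : ContinuousAt (fun x : ℂ => poisedTerm x b q r) 0 := by
      have hq0 : qPoch q q r ≠ 0 := qPoch_ne_zero (mul_pow_self_ne_one hq) r
      unfold poisedTerm
      refine ContinuousAt.div ?_ ?_ (by simpa [qPoch] using hq0) <;> unfold qPoch <;> fun_prop
    exact hcont.tendsto.comp ht
  · rw [norm_mul, norm_pow]
    exact mul_le_of_le_one_right (norm_nonneg a) (pow_le_one₀ (norm_nonneg q) hq.le)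
  · intro k
    -- The denominator factors for `a q^N` are those for `a` with index shifted by `2 * N`, so the
    -- same `δ` works.
    rw [show (a * q ^ N) ^ 2 * q / b * q ^ k = a ^ 2 * q / b * q ^ (2 * N + k) by ring]
    exact hc _

theorem corollary3p4 (a b q : ℂ) (hq : ‖q‖ < min ‖b‖ 1)
    (hden : ∀ k : ℕ, a ^ 2 * q / b * q ^ k ≠ 1) :
    HasSum
      (fun r : ℕ =>
        (1 + a * q ^ r) * qPoch (a ^ 2) q r * qPoch b q r * (-a / b) ^ r * q ^ (r * (r + 1) / 2) /
          (qPoch (a ^ 2 * q / b) q r * qPoch q q r))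
      (qPochInf (-a) q * qPochInf (a ^ 2 * q) (q ^ 2) * qPochInf (a * q / b) q /
        qPochInf (a ^ 2 * q / b) q) := by
  have hq1 : ‖q‖ < 1 := hq.trans_le (min_le_right _ _)
  have hb : b ≠ 0 := norm_pos_iff.1 ((norm_nonneg q).trans_lt (hq.trans_le (min_le_left _ _)))
  have hq2 : ‖q ^ 2‖ < 1 := by
    rw [norm_pow]
    exact pow_lt_one₀ (norm_nonneg q) hq1 two_ne_zero
  have h := (((((tendsto_qPoch hq1 (-a)).mul (tendsto_qPoch hq2 (a ^ 2 * q))).mul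
    (tendsto_qPoch hq1 (a * q / b))).div ((tendsto_qPoch hq1 (a ^ 2 * q / b)).comp
      (Filter.tendsto_id.const_mul_atTop' two_pos)) (qPochInf_ne_zero hq1 hden)).mul
        (tendsto_tsum_poisedTerm hq1 hden)).congr
          fun N => (tsum_poisedTerm_eq_qPoch_mul hb hq1 hden N).symm
  rw [mul_one] at h
  -- The left side of the iterated equation does not depend on `N`, so it equals the limit.
  rw [← tendsto_nhds_unique tendsto_const_nhds h]
  exact (summable_poisedTerm hq1 hden).hasSum
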